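/- Let $\mu$ be a Borel probability measure on $[0,\infty)$ which is non-lattice, i.e. there is no $\kappa>0$ with $\operatorname{supp}(\mu)\subset\kappa\,\mathbb N_0$, and put $F_\mu(x)=\mu([0,x])$. Let $N=\sup\operatorname{supp}(\mu)$, and let $\mathcal C=[0,N]$ if $N<\infty$ and $\mathcal C=[0,\infty)$ if $N=\infty$. Let $Y_1,Y_2,\dots$ be i.i.d. random variables with distribution $\mu$. The reflected random walk started at $x\ge 0$ is $X_0=x$, $X_{n+1}=|X_n-Y_{n+1}|$; its transition kernel is $p(x,B)=\mu(\{y:|x-y|\in B\})$. The reflection times are $\mathbf r(0)=0$, $\mathbf r(k+1)=\inf\{n>\mathbf r(k): X_n=-(X_{n-1}-Y_n)\}$ (almost surely finite), and the process of reflections is the Markov chain $R_k=X_{\mathbf r(k)}$, with transition kernel $q(x,B)=\mathbb P[R_1\in B\mid R_0=x]$. A Radon measure is a Borel measure that is finite on bounded sets; an invariant Radon measure for a kernel $\kappa$ is a nonzero Radon measure $m$ with $\int\kappa(x,B)\,m(dx)=m(B)$ for all Borel sets $B$. Then the measure $\rho$ on $\mathcal C$ given by $$\rho(dx)=\Bigl(\int_{[0,\infty)}\mu\bigl((x,x+y]\bigr)\,\mu(dy)\Bigr)\,dx$$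 is an invariant Radon measure for the process of reflections $(R_k)$. Moreover, let $\nu(dx)=\bigl(1-F_\mu(x)\bigr)\,dx$ on $\mathcal C$. If every invariant Radon measure on $\mathcal C$ for the reflected random walk is a constant multiple of $\nu$, then every invariant Radon measure on $[0,\infty)$ for the process of reflections (in particular, every one on $\mathcal C$) is a constant multiple of $\rho$. -/

import Mathlib

open MeasureTheory ProbabilityTheory Set
open scoped ENNReal NNReal

namespace ReflectedRandomWalk

/-- The reflected walk `X_n^x` driven by the increments `Y_n = ω n` (`n ≥ 1`; the value `ω 0` is
not used): `X_0 = x` and `X_{n+1} = |X_n - Y_{n+1}|`. -/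
def walk (ω : ℕ → ℝ) (x : ℝ) : ℕ → ℝ
  | 0 => x
  | n + 1 => |walk ω x n - ω (n + 1)|

/-- The reflection times: `r(0) = 0` and
`r(k+1) = inf {n > r(k) : X_n = -(X_{n-1} - Y_n)}`. For independent increments that are
non-negative and not almost surely zero, the infimum is over a nonempty set almost surely. -/
noncomputable def reflTime (ω : ℕ → ℝ) (x : ℝ) : ℕ → ℕ
  | 0 => 0
  | k + 1 => sInf {n : ℕ | reflTime ω x k < n ∧ walk ω x n = -(walk ω x (n - 1) - ω n)}

/-- The process of reflections `R_k = X_{r(k)}`. -/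
noncomputable def refl (ω : ℕ → ℝ) (x : ℝ) (k : ℕ) : ℝ := walk ω x (reflTime ω x k)

theorem measurable_walk (n : ℕ) : Measurable fun z : ℝ × (ℕ → ℝ) => walk z.2 z.1 n := by
  induction n with
  | zero => exact measurable_fst
  | succ n ih =>
    have h : Measurable fun z : ℝ × (ℕ → ℝ) => z.2 (n + 1) :=
      (measurable_pi_apply (n + 1)).comp measurable_snd
    exact (ih.sub h).abs

theorem measurable_nat_sInf {α : Type*} [MeasurableSpace α] (S : α → Set ℕ)
    (hS : ∀ n, MeasurableSet {a | n ∈ S a}) : Measurable fun a => sInf (S a) := by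
  refine measurable_to_countable' fun n => ?_
  have h : (fun a => sInf (S a)) ⁻¹' {n} =
      ({a | n ∈ S a} ∩ ⋂ m ∈ Set.Iio n, {a | m ∈ S a}ᶜ) ∪
        ({_a | n = 0} ∩ ⋂ m : ℕ, {a | m ∈ S a}ᶜ) := by
    ext a
    simp only [mem_preimage, mem_singleton_iff, mem_union, mem_inter_iff, mem_ofPred_eq,
      mem_iInter, mem_compl_iff, mem_Iio]
    constructor
    · rintro rfl
      rcases (S a).eq_empty_or_nonempty with he | hne
      · right
        simp [he]
      · left
        exact ⟨Nat.sInf_mem hne, fun m hm => Nat.notMem_of_lt_sInf hm⟩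
    · rintro (⟨h1, h2⟩ | ⟨h1, h2⟩)
      · refine le_antisymm (Nat.sInf_le h1) ?_
        by_contra hlt
        exact h2 _ (not_le.mp hlt) (Nat.sInf_mem ⟨n, h1⟩)
      · have he : S a = ∅ := eq_empty_of_forall_notMem h2
        simp [he, h1]
  rw [h]
  refine MeasurableSet.union ?_ ?_
  · exact (hS n).inter (MeasurableSet.biInter (Set.to_countable _) fun m _ => (hS m).compl)
  · exact (MeasurableSet.const _).inter (MeasurableSet.iInter fun m => (hS m).compl)

theorem measurable_reflTime (k : ℕ) :
    Measurable fun z : ℝ × (ℕ → ℝ) => reflTime z.2 z.1 k := by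
  induction k with
  | zero => exact measurable_const
  | succ k ih =>
    refine measurable_nat_sInf (fun z : ℝ × (ℕ → ℝ) => {n : ℕ | reflTime z.2 z.1 k < n ∧
      walk z.2 z.1 n = -(walk z.2 z.1 (n - 1) - z.2 n)}) fun n => ?_
    have h : Measurable fun z : ℝ × (ℕ → ℝ) => z.2 n :=
      (measurable_pi_apply n).comp measurable_snd
    exact (measurableSet_lt ih measurable_const).inter
      (measurableSet_eq_fun (measurable_walk n) ((measurable_walk (n - 1)).sub h).neg)

theorem measurable_refl (k : ℕ) : Measurable fun z : ℝ × (ℕ → ℝ) => refl z.2 z.1 k := by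
  have h : Measurable fun q : (ℝ × (ℕ → ℝ)) × ℕ => walk q.1.2 q.1.1 q.2 :=
    measurable_from_prod_countable_left fun n => measurable_walk n
  exact h.comp (measurable_id.prodMk (measurable_reflTime k))

/-- The law of the sequence `(Y_n)` of independent random variables with distribution `μ`. -/
noncomputable def incrementLaw (μ : Measure ℝ) [IsProbabilityMeasure μ] : Measure (ℕ → ℝ) :=
  Measure.infinitePi fun _ : ℕ => μ

instance incrementLaw_isProbabilityMeasure (μ : Measure ℝ) [IsProbabilityMeasure μ] :
    IsProbabilityMeasure (incrementLaw μ) := by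
  unfold incrementLaw
  infer_instance

/-- The transition kernel of the reflected random walk: `p(x, B) = μ {y : |x - y| ∈ B}`. -/
noncomputable def walkKernel (μ : Measure ℝ) [IsProbabilityMeasure μ] : Kernel ℝ ℝ where
  toFun x := μ.map fun y => |x - y|
  measurable' := by
    refine Measure.measurable_of_measurable_coe _ fun B hB => ?_
    have hm : Measurable fun z : ℝ × ℝ => |z.1 - z.2| := (measurable_fst.sub measurable_snd).abs
    convert measurable_measure_prodMk_left (ν := μ) (hm hB) using 1
    funext x
    exact (Measure.map_apply (hm.comp measurable_prodMk_left) hB)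

/-- The transition kernel of the process of reflections:
`q(x, B) = P[R_1 ∈ B | R_0 = x]`, that is, `q(x, ·)` is the law of `R_1` for the walk started
at `x`. -/
noncomputable def reflKernel (μ : Measure ℝ) [IsProbabilityMeasure μ] : Kernel ℝ ℝ where
  toFun x := (incrementLaw μ).map fun ω => refl ω x 1
  measurable' := by
    refine Measure.measurable_of_measurable_coe _ fun B hB => ?_
    have hm := measurable_refl 1
    convert measurable_measure_prodMk_left (ν := incrementLaw μ) (hm hB) using 1
    funext x
    exact (Measure.map_apply (hm.comp measurable_prodMk_left) hB)

/-- `μ` is non-lattice: there is no `κ > 0` with `supp μ ⊆ κ ℕ₀`. -/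
def NonLattice (μ : Measure ℝ) : Prop :=
  ¬ ∃ κ : ℝ, 0 < κ ∧ μ.support ⊆ {x : ℝ | ∃ n : ℕ, x = κ * n}

/-- With `N = sup supp μ ∈ [0, ∞]`, this is `[0, N]` if `N < ∞`, and `[0, ∞)` if `N = ∞`. -/
def stateSpace (μ : Measure ℝ) : Set ℝ :=
  {x : ℝ | 0 ≤ x ∧ (x : EReal) ≤ ⨆ y ∈ μ.support, (y : EReal)}

/-- The measure `ν(dx) = (1 - F(x)) dx` on the state space, where `F(x) = μ [0, x]`. -/
noncomputable def nu (μ : Measure ℝ) : Measure ℝ :=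
  (volume.restrict (stateSpace μ)).withDensity fun x => 1 - μ (Icc 0 x)

/-- The measure `ρ(dx) = (∫_{[0, ∞)} μ (x, x + y] μ(dy)) dx` on the state space. -/
noncomputable def rho (μ : Measure ℝ) : Measure ℝ :=
  (volume.restrict (stateSpace μ)).withDensity fun x => ∫⁻ y in Ici 0, μ (Ioc x (x + y)) ∂μ

/-- `m` is a nonzero Radon measure on the (closed) set `S ⊆ ℝ`, viewed as a measure on `ℝ` without
mass outside `S`, and it is invariant for the transition kernel `κ`. -/
structure IsInvariantRadonOn (κ : Kernel ℝ ℝ) (S : Set ℝ) (m : Measure ℝ) : Prop where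
  ne_zero : m ≠ 0
  locallyFinite : IsLocallyFiniteMeasure m
  compl_eq_zero : m Sᶜ = 0
  invariant : κ.Invariant m

end ReflectedRandomWalk

namespace ReflectedRandomWalk
section

/-! ### The non-reflecting and the reflecting part of a step -/

/-! Split a step of the walk as `A + B`, where `A` (`downKernel`) is the part without reflection and
`B` (`upKernel`) the reflected part. Waiting for the first reflection gives `q = ∑ Aᵏ B` on the
half-line (`lintegral_reflKernel_eq_tsum`). This needs the walk killed at its first reflection to be
transient: `x ↦ 1 + x` is strictly superharmonic for `A`, so `∑ Aᵏ 1` is at most a multiple of `1 +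
x` (`tsum_down_iterate_one_le`).

Two identities link `ν` and `ρ`: `ρ = ν B` (`setLIntegral_tail_mul_up`) and `ν = ρ + ν A` (from
`tail_eq`). Iterating the second, with `ν Aⁿ → 0`, gives `ν = ∑ ρ Aᵏ`
(`tsum_rhoDensity_mul_down_iterate`). Hence `ρ q = ∑ ρ Aᵏ B = ν B = ρ`.

For uniqueness, let `m` be invariant for `q` and put `M = ∑ m Aᵏ` (`potentialMeasure`). Then `M B =
m q = m` and `M = m + M A`, so `M (A + B) = M`. The measure `M` is Radon and lives on the state
space, so the assumption gives `M = c ν`, and then `m = M B = c ν B = c ρ`. -/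

/-- The kernel of a step of the walk without reflection: `x ↦ x - Y` on the event `Y < x`. -/
noncomputable def downKernel (μ : Measure ℝ) [IsProbabilityMeasure μ] : Kernel ℝ ℝ where
  toFun x := (μ.restrict (Iio x)).map fun y => x - y
  measurable' := by
    refine Measure.measurable_of_measurable_coe _ fun B hB => ?_
    have hS : MeasurableSet {z : ℝ × ℝ | z.1 - z.2 ∈ B ∧ z.2 < z.1} :=
      ((measurable_fst.sub measurable_snd) hB).inter
        (measurableSet_lt measurable_snd measurable_fst)
    convert measurable_measure_prodMk_left (ν := μ) hS using 1
    funext x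
    have hm : Measurable fun y : ℝ => x - y := measurable_const.sub measurable_id
    rw [Measure.map_apply hm hB, Measure.restrict_apply (hm hB)]
    rfl

/-- The kernel of a step of the walk with reflection: `x ↦ Y - x` on the event `x ≤ Y`. -/
noncomputable def upKernel (μ : Measure ℝ) [IsProbabilityMeasure μ] : Kernel ℝ ℝ where
  toFun x := (μ.restrict (Ici x)).map fun y => y - x
  measurable' := by
    refine Measure.measurable_of_measurable_coe _ fun B hB => ?_
    have hS : MeasurableSet {z : ℝ × ℝ | z.2 - z.1 ∈ B ∧ z.1 ≤ z.2} :=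
      ((measurable_snd.sub measurable_fst) hB).inter
        (measurableSet_le measurable_fst measurable_snd)
    convert measurable_measure_prodMk_left (ν := μ) hS using 1
    funext x
    have hm : Measurable fun y : ℝ => y - x := measurable_id.sub measurable_const
    rw [Measure.map_apply hm hB, Measure.restrict_apply (hm hB)]
    rfl

/-- The operator on functions given by `downKernel`. -/
noncomputable def down (μ : Measure ℝ) [IsProbabilityMeasure μ] (f : ℝ → ℝ≥0∞) (x : ℝ) : ℝ≥0∞ :=
  ∫⁻ z, f z ∂downKernel μ x

/-- The operator on functions given by `upKernel`. -/
noncomputable def up (μ : Measure ℝ) [IsProbabilityMeasure μ] (f : ℝ → ℝ≥0∞) (x : ℝ) : ℝ≥0∞ :=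
  ∫⁻ z, f z ∂upKernel μ x

/-- The truncated mean `∫ min(y, 1) μ(dy)`. -/
noncomputable def truncMean (μ : Measure ℝ) : ℝ≥0∞ := ∫⁻ y, ENNReal.ofReal (min y 1) ∂μ

/-- Otherwise `μ` is the point mass at 0, whose support is lattice. Excluding this case is all that
the non-lattice hypothesis contributes to the proof. -/
theorem truncMean_pos {μ : Measure ℝ} (hμ : μ (Iio 0) = 0) (hnl : NonLattice μ) : 0 < truncMean μ := by
  rw [pos_iff_ne_zero]
  intro h
  have hm : Measurable fun y : ℝ => ENNReal.ofReal (min y 1) := by fun_prop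
  rw [truncMean, lintegral_eq_zero_iff hm] at h
  have h0 : ({0} : Set ℝ) ∈ ae μ := by
    filter_upwards [h, measure_eq_zero_iff_ae_notMem.1 hμ] with y hy hy0
    have h1 : min y 1 ≤ 0 := ENNReal.ofReal_eq_zero.1 hy
    rw [mem_Iio, not_lt] at hy0
    rcases min_le_iff.1 h1 with h1 | h1
    · exact le_antisymm h1 hy0
    · exact absurd h1 (by norm_num)
  refine hnl ⟨1, one_pos, (Measure.support_subset_of_isClosed isClosed_singleton h0).trans ?_⟩
  rintro x rfl
  exact ⟨0, by simp⟩

variable {μ : Measure ℝ} [IsProbabilityMeasure μ] {f g : ℝ → ℝ≥0∞}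

theorem measurable_down (hf : Measurable f) : Measurable (down μ f) := hf.lintegral_kernel

theorem measurable_up (hf : Measurable f) : Measurable (up μ f) := hf.lintegral_kernel

theorem measurable_down_iterate (hf : Measurable f) (n : ℕ) : Measurable ((down μ)^[n] f) := by
  induction n with
  | zero => exact hf
  | succ n ih => rw [Function.iterate_succ_apply']; exact measurable_down ih

theorem down_apply (hf : Measurable f) (x : ℝ) :
    down μ f x = ∫⁻ y in Iio x, f (x - y) ∂μ :=
  lintegral_map hf (measurable_const.sub measurable_id)

theorem up_apply (hf : Measurable f) (x : ℝ) :
    up μ f x = ∫⁻ y in Ici x, f (y - x) ∂μ :=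
  lintegral_map hf (measurable_id.sub measurable_const)

/-- The tie `Y = x` is put into the reflected part, in agreement with the defining equation of the
reflection times. -/
theorem lintegral_walkKernel (hf : Measurable f) (x : ℝ) :
    ∫⁻ z, f z ∂walkKernel μ x = down μ f x + up μ f x := by
  have h : ∫⁻ z, f z ∂walkKernel μ x = ∫⁻ y, f |x - y| ∂μ :=
    lintegral_map hf (measurable_const.sub measurable_id).abs
  rw [h, down_apply hf, up_apply hf, ← lintegral_add_compl _ (measurableSet_Iio (a := x)),
    compl_Iio]
  congr 1
  · refine setLIntegral_congr_fun measurableSet_Iio fun y hy => ?_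
    rw [mem_Iio] at hy
    simp only [abs_of_pos (sub_pos.2 hy)]
  · refine setLIntegral_congr_fun measurableSet_Ici fun y hy => ?_
    rw [mem_Ici] at hy
    simp only [abs_of_nonpos (sub_nonpos.2 hy), neg_sub]

theorem down_add (hf : Measurable f) (x : ℝ) :
    down μ (fun z => f z + g z) x = down μ f x + down μ g x :=
  lintegral_add_left hf _

theorem down_const_mul (hf : Measurable f) (c : ℝ≥0∞) (x : ℝ) :
    down μ (fun z => c * f z) x = c * down μ f x :=
  lintegral_const_mul _ hf

theorem down_sum_iterate (hf : Measurable f) (n : ℕ) (x : ℝ) :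
    down μ (fun z => ∑ k ∈ Finset.range n, (down μ)^[k] f z) x =
      ∑ k ∈ Finset.range n, (down μ)^[k + 1] f x := by
  rw [down, lintegral_finsetSum _ fun k _ => measurable_down_iterate hf k]
  refine Finset.sum_congr rfl fun k _ => ?_
  rw [Function.iterate_succ_apply']
  rfl

/-- Because of this, pointwise estimates on the half-line are enough when iterating `down`. -/
theorem ae_downKernel_pos (x : ℝ) : ∀ᵐ z ∂downKernel μ x, 0 < z := by
  change ∀ᵐ z ∂((μ.restrict (Iio x)).map fun y => x - y), 0 < z
  have hm : Measurable fun y : ℝ => x - y := by fun_prop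
  rw [ae_map_iff hm.aemeasurable measurableSet_Ioi, ae_restrict_iff' measurableSet_Iio]
  exact ae_of_all _ fun y hy => sub_pos.2 hy

theorem down_mono (h : ∀ z, 0 < z → f z ≤ g z) (x : ℝ) : down μ f x ≤ down μ g x :=
  lintegral_mono_ae <| (ae_downKernel_pos x).mono h

theorem down_congr (h : ∀ z, 0 < z → f z = g z) (x : ℝ) : down μ f x = down μ g x :=
  lintegral_congr_ae <| (ae_downKernel_pos x).mono h

theorem down_iterate_mono (h : ∀ z, 0 ≤ z → f z ≤ g z) (n : ℕ) :
    ∀ x, 0 ≤ x → (down μ)^[n] f x ≤ (down μ)^[n] g x := by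
  induction n with
  | zero => exact h
  | succ n ih =>
    intro x _
    rw [Function.iterate_succ_apply', Function.iterate_succ_apply']
    exact down_mono (fun z hz => ih z hz.le) x

theorem down_iterate_one_le (n : ℕ) (x : ℝ) : (down μ)^[n] 1 x ≤ 1 := by
  induction n generalizing x with
  | zero => exact le_rfl
  | succ n ih =>
    rw [Function.iterate_succ_apply', down_apply (measurable_down_iterate measurable_one n)]
    calc _ ≤ ∫⁻ _ in Iio x, 1 ∂μ := lintegral_mono fun y => ih _
      _ ≤ 1 := by simpa using prob_le_one

/-! ### The potential of the killed walk -/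

theorem truncMean_le_one : truncMean μ ≤ 1 := by
  calc truncMean μ ≤ ∫⁻ _, 1 ∂μ := lintegral_mono fun y => by simp
    _ = 1 := by simp

/-- `x ↦ 1 + x` is strictly superharmonic for the killed walk. -/
theorem down_add_truncMean_le (hμ : μ (Iio 0) = 0) {x : ℝ} (hx : 0 ≤ x) :
    truncMean μ + down μ (fun z => ENNReal.ofReal (1 + z)) x ≤ ENNReal.ofReal (1 + x) := by
  have hm : Measurable fun z : ℝ => ENNReal.ofReal (1 + z) := by fun_prop
  rw [down_apply hm, ← lintegral_indicator measurableSet_Iio, truncMean,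
    ← lintegral_add_left (by fun_prop)]
  calc _ ≤ ∫⁻ _, ENNReal.ofReal (1 + x) ∂μ := by
        refine lintegral_mono_ae ?_
        filter_upwards [measure_eq_zero_iff_ae_notMem.1 hμ] with y hy
        rw [mem_Iio, not_lt] at hy
        -- Without reflection `1 + x` drops by `y ≥ min y 1`; at a reflection all of `1 + x ≥ 1` is
        -- lost.
        by_cases hyx : y < x
        · rw [indicator_of_mem (mem_Iio.2 hyx), ← ENNReal.ofReal_add (le_min hy zero_le_one)
            (by linarith)]
          exact ENNReal.ofReal_le_ofReal (by linarith [min_le_left y 1])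
        · rw [indicator_of_notMem (by simpa using hyx), add_zero]
          exact ENNReal.ofReal_le_ofReal (by linarith [min_le_right y 1])
    _ = _ := by simp

/-- With `φ = 1 + x`, `c = truncMean μ` and partial sums `Sₙ`, superharmonicity propagates the
bound: `c Sₙ₊₁ = c + A (c Sₙ) ≤ c + A φ ≤ φ`. -/
theorem sum_down_iterate_one_le (hμ : μ (Iio 0) = 0) (n : ℕ) {x : ℝ} (hx : 0 ≤ x) :
    truncMean μ * ∑ k ∈ Finset.range n, (down μ)^[k] 1 x ≤ ENNReal.ofReal (1 + x) := by
  induction n generalizing x with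
  | zero => simp
  | succ n ih =>
    have hms : Measurable fun z => ∑ k ∈ Finset.range n, (down μ)^[k] (1 : ℝ → ℝ≥0∞) z :=
      Finset.measurable_sum _ fun k _ => measurable_down_iterate measurable_one k
    rw [Finset.sum_range_succ', ← down_sum_iterate measurable_one, mul_add, ← down_const_mul hms, add_comm]
    refine le_trans ?_ (down_add_truncMean_le hμ hx)
    simp only [Function.iterate_zero, id, Pi.one_apply, mul_one]
    gcongr
    exact down_mono (fun z hz => ih hz.le) x

theorem truncMean_mul_tsum_le (hμ : μ (Iio 0) = 0) {x : ℝ} (hx : 0 ≤ x) :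
    truncMean μ * ∑' k, (down μ)^[k] 1 x ≤ ENNReal.ofReal (1 + x) := by
  rw [ENNReal.tsum_eq_iSup_nat, ENNReal.mul_iSup]
  exact iSup_le fun n => sum_down_iterate_one_le hμ n hx

theorem tsum_down_iterate_one_le (hμ : μ (Iio 0) = 0) (hnl : NonLattice μ) {x : ℝ}
    (hx : 0 ≤ x) : ∑' k, (down μ)^[k] 1 x ≤ ENNReal.ofReal (1 + x) / truncMean μ := by
  rw [ENNReal.le_div_iff_mul_le (.inl (truncMean_pos hμ hnl).ne')
    (.inl (truncMean_le_one.trans_lt ENNReal.one_lt_top).ne), mul_comm]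
  exact truncMean_mul_tsum_le hμ hx

theorem tendsto_down_iterate_one (hμ : μ (Iio 0) = 0) (hnl : NonLattice μ) {x : ℝ}
    (hx : 0 ≤ x) : Filter.Tendsto (fun n => (down μ)^[n] 1 x) Filter.atTop (nhds 0) := by
  refine ENNReal.tendsto_atTop_zero_of_tsum_ne_top
    ((tsum_down_iterate_one_le hμ hnl hx).trans_lt ?_).ne
  exact ENNReal.div_lt_top ENNReal.ofReal_ne_top (truncMean_pos hμ hnl).ne'

/-- A bounded function with `h = g + down h` on the half-line is the potential of `g`. -/
theorem eq_tsum_down_iterate (hμ : μ (Iio 0) = 0) (hnl : NonLattice μ) {h : ℝ → ℝ≥0∞}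
    (hg : Measurable g) (h1 : ∀ x, h x ≤ 1)
    (heq : ∀ x, 0 ≤ x → h x = g x + down μ h x) {x : ℝ} (hx : 0 ≤ x) :
    h x = ∑' k, (down μ)^[k] g x := by
  -- Iterate `h = g + A h`; the remainder `Aⁿ h ≤ Aⁿ 1` tends to 0.
  have key : ∀ n, ∀ x, 0 ≤ x →
      h x = ∑ k ∈ Finset.range n, (down μ)^[k] g x + (down μ)^[n] h x := by
    intro n
    induction n with
    | zero => simp
    | succ n ih =>
      intro x hx
      have hms : Measurable fun z => ∑ k ∈ Finset.range n, (down μ)^[k] g z :=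
        Finset.measurable_sum _ fun k _ => measurable_down_iterate hg k
      rw [heq x hx, down_congr (fun z hz => ih z hz.le), down_add hms, down_sum_iterate hg,
        Finset.sum_range_succ', Function.iterate_succ_apply', ← add_assoc,
        add_comm (∑ k ∈ Finset.range n, _), Function.iterate_zero, id]
  have hlim : Filter.Tendsto (fun n => (down μ)^[n] h x) Filter.atTop (nhds 0) :=
    tendsto_of_tendsto_of_tendsto_of_le_of_le tendsto_const_nhds
      (tendsto_down_iterate_one hμ hnl hx) (fun n => zero_le)
      fun n => down_iterate_mono (fun z _ => h1 z) n x hx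
  have hadd := (ENNReal.summable.hasSum (f := fun k => (down μ)^[k] g x)).tendsto_sum_nat.add hlim
  rw [add_zero] at hadd
  refine tendsto_nhds_unique ?_ hadd
  simp_rw [← key _ x hx]
  exact tendsto_const_nhds

end
section

/-! ### First step analysis of the process of reflections -/

/-- Insert `y` as the first increment, in front of the increments of `ω`. -/
def insertIncrement (y : ℝ) (ω : ℕ → ℝ) : ℕ → ℝ
  | 0 => ω 0
  | 1 => y
  | n + 2 => ω (n + 1)

theorem measurable_insertIncrement :
    Measurable fun z : ℝ × (ℕ → ℝ) => insertIncrement z.1 z.2 := by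
  refine measurable_pi_lambda _ fun n => ?_
  match n with
  | 0 => exact (measurable_pi_apply 0).comp measurable_snd
  | 1 => exact measurable_fst
  | n + 2 => exact (measurable_pi_apply (n + 1)).comp measurable_snd

/-- A product measure is determined by its values on boxes, and inserting a coordinate only relabels
the factors. Coordinate 0, which the walk never reads, stays in place. -/
theorem map_insertIncrement (μ : Measure ℝ) [IsProbabilityMeasure μ] :
    (μ.prod (incrementLaw μ)).map (fun z => insertIncrement z.1 z.2) = incrementLaw μ := by
  classical
  refine Measure.eq_infinitePi _ fun s t ht => ?_
  -- Pad the box with `univ` to an initial segment that contains both coordinates 0 and 1.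
  obtain ⟨n, hn⟩ : ∃ n, s ⊆ Finset.range (n + 2) :=
    ⟨s.sup id, fun i hi => Finset.mem_range.2
      ((Finset.le_sup (f := id) hi).trans_lt (by simp))⟩
  set t' : ℕ → Set ℝ := fun i => if i ∈ s then t i else univ with ht'
  have hmt' : ∀ i, MeasurableSet (t' i) := fun i => by
    simp only [ht']; split_ifs; exacts [ht i, MeasurableSet.univ]
  have hpi : (s : Set ℕ).pi t = (Finset.range (n + 2) : Set ℕ).pi t' := by
    ext ω
    simp only [Set.mem_pi, Finset.mem_coe, ht']
    constructor
    · intro h i _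
      split_ifs with hi
      exacts [h i hi, mem_univ _]
    · intro h i hi
      simpa [hi] using h i (hn hi)
  have hprod : ∏ i ∈ s, μ (t i) = ∏ i ∈ Finset.range (n + 2), μ (t' i) := by
    rw [← Finset.prod_subset hn fun i _ hi => by simp [ht', hi]]
    exact Finset.prod_congr rfl fun i hi => by simp [ht', hi]
  -- The sides of the box with coordinate 1 deleted.
  set t'' : ℕ → Set ℝ := fun i => if i = 0 then t' 0 else t' (i + 1) with ht''
  have hmt'' : ∀ i, MeasurableSet (t'' i) := fun i => by
    simp only [ht'']; split_ifs; exacts [hmt' 0, hmt' (i + 1)]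
  have hpre : (fun z : ℝ × (ℕ → ℝ) => insertIncrement z.1 z.2) ⁻¹'
      ((Finset.range (n + 2) : Set ℕ).pi t') =
      t' 1 ×ˢ (Finset.range (n + 1) : Set ℕ).pi t'' := by
    ext ⟨y, ω⟩
    simp only [mem_preimage, Set.mem_pi, Finset.mem_coe, Finset.mem_range, mem_prod, ht'']
    constructor
    · refine fun h => ⟨h 1 (by omega), fun i hi => ?_⟩
      match i with
      | 0 => exact h 0 (by omega)
      | i + 1 => exact h (i + 2) (by omega)
    · rintro ⟨h1, h⟩ i hi
      match i with
      | 0 => exact h 0 (by omega)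
      | 1 => exact h1
      | i + 2 => exact h (i + 1) (by omega)
  rw [hpi, hprod, Measure.map_apply measurable_insertIncrement
    (MeasurableSet.pi (Finset.countable_toSet _) fun i _ => hmt' i), hpre, Measure.prod_prod,
    incrementLaw, Measure.infinitePi_pi _ fun i _ => hmt'' i, Finset.prod_range_succ',
    Finset.prod_range_succ' _ (n + 1), Finset.prod_range_succ']
  simp only [ht'', if_true, Nat.add_eq_zero_iff, one_ne_zero, and_false, if_false]
  ring

/-- Conditioning on the first increment. -/
theorem lintegral_incrementLaw (μ : Measure ℝ) [IsProbabilityMeasure μ] {F : (ℕ → ℝ) → ℝ≥0∞}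
    (hF : Measurable F) :
    ∫⁻ ω, F ω ∂incrementLaw μ = ∫⁻ y, ∫⁻ ω, F (insertIncrement y ω) ∂incrementLaw μ ∂μ := by
  conv_lhs => rw [← map_insertIncrement μ, lintegral_map hF measurable_insertIncrement]
  exact lintegral_prod _ (hF.comp measurable_insertIncrement).aemeasurable

/-- Pathwise Markov property after a first step without reflection. -/
theorem walk_insertIncrement {x y : ℝ} (h : y < x) (ω : ℕ → ℝ) (n : ℕ) :
    walk (insertIncrement y ω) x (n + 1) = walk ω (x - y) n := by
  induction n with
  | zero => exact abs_of_pos (sub_pos.2 h)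
  | succ n ih => rw [walk, ih]; rfl

/-- The times at which the walk started at `x` is reflected. -/
def reflTimes (ω : ℕ → ℝ) (x : ℝ) : Set ℕ :=
  {n | 0 < n ∧ walk ω x n = -(walk ω x (n - 1) - ω n)}

theorem reflTime_one (ω : ℕ → ℝ) (x : ℝ) : reflTime ω x 1 = sInf (reflTimes ω x) := rfl

theorem succ_mem_reflTimes {ω : ℕ → ℝ} {x : ℝ} {n : ℕ} :
    n + 1 ∈ reflTimes ω x ↔ walk ω x n ≤ ω (n + 1) := by
  simp only [reflTimes, mem_ofPred_eq, Nat.add_sub_cancel, walk, abs_eq_neg_self, sub_nonpos]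
  simp

theorem zero_notMem_reflTimes {ω : ℕ → ℝ} {x : ℝ} : 0 ∉ reflTimes ω x := fun h => h.1.false

theorem succ_mem_reflTimes_insertIncrement {x y : ℝ} (h : y < x) (ω : ℕ → ℝ) (n : ℕ) :
    n + 1 ∈ reflTimes (insertIncrement y ω) x ↔ n ∈ reflTimes ω (x - y) := by
  rw [succ_mem_reflTimes]
  cases n with
  | zero => exact iff_of_false (not_le.2 h) zero_notMem_reflTimes
  | succ n => rw [walk_insertIncrement h, succ_mem_reflTimes]; rfl

theorem reflTimes_insertIncrement_nonempty {x y : ℝ} (h : y < x) (ω : ℕ → ℝ) :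
    (reflTimes (insertIncrement y ω) x).Nonempty ↔ (reflTimes ω (x - y)).Nonempty := by
  constructor
  · rintro ⟨_ | n, hn⟩
    · exact absurd hn zero_notMem_reflTimes
    · exact ⟨n, (succ_mem_reflTimes_insertIncrement h ω n).1 hn⟩
  · rintro ⟨n, hn⟩
    exact ⟨n + 1, (succ_mem_reflTimes_insertIncrement h ω n).2 hn⟩

theorem one_mem_reflTimes_insertIncrement {x y : ℝ} (h : x ≤ y) (ω : ℕ → ℝ) :
    1 ∈ reflTimes (insertIncrement y ω) x :=
  succ_mem_reflTimes.2 h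

theorem refl_insertIncrement_of_le {x y : ℝ} (h : x ≤ y) (ω : ℕ → ℝ) :
    refl (insertIncrement y ω) x 1 = y - x := by
  have h1 : reflTime (insertIncrement y ω) x 1 = 1 := by
    have hmem := one_mem_reflTimes_insertIncrement h ω
    rw [reflTime_one]
    refine le_antisymm (Nat.sInf_le hmem) (Nat.sInf_mem ⟨1, hmem⟩).1
  rw [refl, h1]
  exact (abs_of_nonpos (sub_nonpos.2 h)).trans (neg_sub _ _)

/-- Both reflection times differ by the one inserted step. Nonemptiness matters: `sInf ∅ = 0` would
make the two sides `x` and `x - y`. -/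
theorem refl_insertIncrement_of_lt {x y : ℝ} (h : y < x) {ω : ℕ → ℝ}
    (hne : (reflTimes ω (x - y)).Nonempty) :
    refl (insertIncrement y ω) x 1 = refl ω (x - y) 1 := by
  have h1 : reflTime (insertIncrement y ω) x 1 = reflTime ω (x - y) 1 + 1 := by
    rw [reflTime_one, reflTime_one]
    refine le_antisymm
      (Nat.sInf_le ((succ_mem_reflTimes_insertIncrement h ω _).2 (Nat.sInf_mem hne))) ?_
    have hmem := Nat.sInf_mem ((reflTimes_insertIncrement_nonempty h ω).2 hne)
    obtain ⟨n, hn⟩ : ∃ n, sInf (reflTimes (insertIncrement y ω) x) = n + 1 :=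
      Nat.exists_eq_succ_of_ne_zero hmem.1.ne'
    rw [hn] at hmem ⊢
    exact Nat.succ_le_succ (Nat.sInf_le ((succ_mem_reflTimes_insertIncrement h ω n).1 hmem))
  rw [refl, h1, walk_insertIncrement h, refl]

theorem measurableSet_mem_reflTimes (n : ℕ) :
    MeasurableSet {z : ℝ × (ℕ → ℝ) | n ∈ reflTimes z.2 z.1} := by
  have h : Measurable fun z : ℝ × (ℕ → ℝ) => z.2 n := (measurable_pi_apply n).comp measurable_snd
  exact (MeasurableSet.const _).inter
    (measurableSet_eq_fun (measurable_walk n) ((measurable_walk (n - 1)).sub h).neg)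

theorem measurableSet_reflTimes_eq_empty :
    MeasurableSet {z : ℝ × (ℕ → ℝ) | reflTimes z.2 z.1 = ∅} := by
  simp only [eq_empty_iff_forall_notMem, ofPred_forall]
  exact MeasurableSet.iInter fun n => (measurableSet_mem_reflTimes n).compl

variable {μ : Measure ℝ} [IsProbabilityMeasure μ] {f : ℝ → ℝ≥0∞}

/-- Almost surely, the walk is eventually reflected. -/
theorem ae_reflTimes_nonempty (hμ : μ (Iio 0) = 0) (hnl : NonLattice μ) {x : ℝ} (hx : 0 ≤ x) :
    ∀ᵐ ω ∂incrementLaw μ, (reflTimes ω x).Nonempty := by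
  set h : ℝ → ℝ≥0∞ := fun x => incrementLaw μ {ω | reflTimes ω x = ∅} with hh
  have hmeas : Measurable h := measurable_measure_prodMk_left measurableSet_reflTimes_eq_empty
  have hmS : ∀ x, MeasurableSet {ω | reflTimes ω x = ∅} := fun x =>
    measurable_prodMk_left measurableSet_reflTimes_eq_empty
  -- The probability `h` of never being reflected satisfies `h = A h`; being bounded, it is the
  -- potential of 0.
  have heq : ∀ x, 0 ≤ x → h x = (0 : ℝ → ℝ≥0∞) x + down μ h x := by
    intro x _
    rw [down_apply hmeas, Pi.zero_apply, zero_add, hh]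
    simp only
    rw [← lintegral_indicator_one (hmS x),
      lintegral_incrementLaw μ (measurable_one.indicator (hmS x)),
      ← lintegral_indicator measurableSet_Iio]
    refine lintegral_congr fun y => ?_
    by_cases hyx : y < x
    · rw [indicator_of_mem (mem_Iio.2 hyx), ← lintegral_indicator_one (hmS (x - y))]
      refine lintegral_congr fun ω => ?_
      refine indicator_eq_indicator ?_ rfl
      simp only [mem_ofPred_eq, ← not_nonempty_iff_eq_empty,
        reflTimes_insertIncrement_nonempty hyx]
    · rw [indicator_of_notMem (by simpa using hyx)]
      refine (lintegral_congr fun ω => indicator_of_notMem ?_ _).trans lintegral_zero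
      exact fun h0 => (nonempty_iff_ne_empty.1
        ⟨1, one_mem_reflTimes_insertIncrement (not_lt.1 hyx) ω⟩) h0
  have hzero := eq_tsum_down_iterate hμ hnl measurable_zero (fun x => prob_le_one) heq hx
  have hit : ∀ k x, (down μ)^[k] 0 x = 0 := by
    intro k
    induction k with
    | zero => exact fun _ => rfl
    | succ k ih =>
      intro x
      rw [Function.iterate_succ_apply', down, lintegral_congr ih, lintegral_zero]
  simp only [hit, tsum_zero] at hzero
  filter_upwards [measure_eq_zero_iff_ae_notMem.1 hzero] with ω hω
  exact nonempty_iff_ne_empty.2 hω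

theorem lintegral_reflKernel (hf : Measurable f) (x : ℝ) :
    ∫⁻ z, f z ∂reflKernel μ x = ∫⁻ ω, f (refl ω x 1) ∂incrementLaw μ :=
  lintegral_map hf ((measurable_refl 1).comp measurable_prodMk_left)

/-- Conditioning on the first increment gives `q = B + A q`. -/
theorem lintegral_reflKernel_eq_up_add_down (hμ : μ (Iio 0) = 0) (hnl : NonLattice μ)
    (hf : Measurable f) (x : ℝ) :
    ∫⁻ z, f z ∂reflKernel μ x = up μ f x + down μ (fun u => ∫⁻ z, f z ∂reflKernel μ u) x := by
  have hm : ∀ x, Measurable fun ω => f (refl ω x 1) := fun x =>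
    hf.comp ((measurable_refl 1).comp measurable_prodMk_left)
  rw [lintegral_reflKernel hf, lintegral_incrementLaw μ (hm x), up_apply hf,
    down_apply hf.lintegral_kernel, ← lintegral_add_compl _ (measurableSet_Ici (a := x)),
    compl_Ici]
  congr 1
  · refine setLIntegral_congr_fun measurableSet_Ici fun y hy => ?_
    simp [refl_insertIncrement_of_le (mem_Ici.1 hy)]
  · refine setLIntegral_congr_fun measurableSet_Iio fun y hy => ?_
    rw [lintegral_reflKernel hf]
    refine lintegral_congr_ae ?_
    filter_upwards [ae_reflTimes_nonempty hμ hnl (sub_nonneg.2 (mem_Iio.1 hy).le)] with ω hω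
    rw [refl_insertIncrement_of_lt hy hω]

instance : IsMarkovKernel (reflKernel μ) :=
  ⟨fun _ => Measure.isProbabilityMeasure_map
    ((measurable_refl 1).comp measurable_prodMk_left).aemeasurable⟩

/-- The kernel of the process of reflections is the potential of the killed walk, followed by a
reflected step. -/
theorem lintegral_reflKernel_eq_tsum (hμ : μ (Iio 0) = 0) (hnl : NonLattice μ)
    (hf : Measurable f) (hf1 : ∀ x, f x ≤ 1) {x : ℝ} (hx : 0 ≤ x) :
    ∫⁻ z, f z ∂reflKernel μ x = ∑' k, (down μ)^[k] (up μ f) x := by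
  refine eq_tsum_down_iterate hμ hnl (h := fun u => ∫⁻ z, f z ∂reflKernel μ u)
    (measurable_up hf) (fun u => ?_)
    (fun u _ => lintegral_reflKernel_eq_up_add_down hμ hnl hf u) hx
  calc ∫⁻ z, f z ∂reflKernel μ u ≤ ∫⁻ _, 1 ∂reflKernel μ u := lintegral_mono hf1
    _ = 1 := by simp

end
section

/-! ### Duality with respect to Lebesgue measure -/

variable {μ : Measure ℝ} [IsProbabilityMeasure μ] {f t : ℝ → ℝ≥0∞}

theorem down_eq_zero (hμ : μ (Iio 0) = 0) (hf : Measurable f) {x : ℝ} (hx : x ≤ 0) :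
    down μ f x = 0 := by
  rw [down_apply hf]
  exact setLIntegral_measure_zero _ _ (measure_mono_null (Iio_subset_Iio hx) hμ)

theorem down_apply_indicator (hf : Measurable f) (x : ℝ) :
    down μ f x = ∫⁻ y, (Ioi 0).indicator f (x - y) ∂μ := by
  rw [down_apply hf, ← lintegral_indicator measurableSet_Iio]
  refine lintegral_congr fun y => ?_
  by_cases h : y < x
  · rw [indicator_of_mem (mem_Iio.2 h), indicator_of_mem (mem_Ioi.2 (sub_pos.2 h))]
  · rw [indicator_of_notMem (by simpa using h), indicator_of_notMem (by simpa using h)]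

theorem up_apply_indicator (hf : Measurable f) (x : ℝ) :
    up μ f x = ∫⁻ y, (Ici 0).indicator f (y - x) ∂μ := by
  rw [up_apply hf, ← lintegral_indicator measurableSet_Ici]
  refine lintegral_congr fun y => ?_
  by_cases h : x ≤ y
  · rw [indicator_of_mem (mem_Ici.2 h), indicator_of_mem (mem_Ici.2 (sub_nonneg.2 h))]
  · rw [indicator_of_notMem (by simpa using h), indicator_of_notMem (by simpa using h)]

theorem setLIntegral_mul_eq {s : Set ℝ} (hs : MeasurableSet s) (f g : ℝ → ℝ≥0∞) :
    ∫⁻ x in s, f x * g x = ∫⁻ x, f x * s.indicator g x := by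
  rw [← lintegral_indicator hs]
  simp_rw [indicator_mul_right]

/-- The dual of `down` with respect to Lebesgue measure. -/
noncomputable def shift (μ : Measure ℝ) (t : ℝ → ℝ≥0∞) (x : ℝ) : ℝ≥0∞ := ∫⁻ y, t (x + y) ∂μ

theorem measurable_shift (ht : Measurable t) : Measurable (shift μ t) :=
  Measurable.lintegral_prod_right' (f := fun z : ℝ × ℝ => t (z.1 + z.2)) (by fun_prop)

theorem measurable_shift_iterate (ht : Measurable t) (n : ℕ) :
    Measurable ((shift μ)^[n] t) := by
  induction n with
  | zero => exact ht
  | succ n ih => rw [Function.iterate_succ_apply']; exact measurable_shift ih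

/-- Fubini and the translation `x ↦ x + y`, which preserves Lebesgue measure. -/
theorem setLIntegral_mul_down (hμ : μ (Iio 0) = 0) (ht : Measurable t) (hf : Measurable f) :
    ∫⁻ x in Ioi 0, t x * down μ f x = ∫⁻ x in Ioi 0, shift μ t x * f x := by
  have hF : Measurable ((Ioi 0).indicator f) := hf.indicator measurableSet_Ioi
  have hind : (Ioi 0).indicator (down μ f) = down μ f :=
    indicator_eq_self.2 fun x hx => by
      by_contra h
      exact hx (down_eq_zero hμ hf (not_lt.1 h))
  calc ∫⁻ x in Ioi 0, t x * down μ f x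
      = ∫⁻ x, ∫⁻ y, t x * (Ioi 0).indicator f (x - y) ∂μ := by
        rw [setLIntegral_mul_eq measurableSet_Ioi, hind]
        refine lintegral_congr fun x => ?_
        rw [down_apply_indicator hf, lintegral_const_mul _ (by fun_prop)]
    _ = ∫⁻ y, (∫⁻ x, t x * (Ioi 0).indicator f (x - y)) ∂μ := by
        refine lintegral_lintegral_swap ?_
        fun_prop
    _ = ∫⁻ y, (∫⁻ x, t (x + y) * (Ioi 0).indicator f x) ∂μ := by
        refine lintegral_congr fun y => ?_
        rw [← lintegral_sub_right_eq_self (μ := volume) (fun x => t (x + y) * (Ioi 0).indicator f x) y]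
        simp
    _ = ∫⁻ x, ∫⁻ y, t (x + y) * (Ioi 0).indicator f x ∂μ := by
        refine lintegral_lintegral_swap ?_
        fun_prop
    _ = _ := by
        rw [setLIntegral_mul_eq measurableSet_Ioi]
        exact lintegral_congr fun x => lintegral_mul_const _ (by fun_prop)

/-- Fubini and the point reflection `x ↦ y - x`, which preserves Lebesgue measure. -/
theorem setLIntegral_mul_up (ht : Measurable t) (hf : Measurable f) :
    ∫⁻ x in Ioi 0, t x * up μ f x =
      ∫⁻ x in Ioi 0, (∫⁻ y, (Ioi 0).indicator t (y - x) ∂μ) * f x := by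
  have hF : Measurable ((Ici 0).indicator f) := hf.indicator measurableSet_Ici
  have hT : Measurable ((Ioi 0).indicator t) := ht.indicator measurableSet_Ioi
  calc ∫⁻ x in Ioi 0, t x * up μ f x
      = ∫⁻ x, ∫⁻ y, (Ioi 0).indicator t x * (Ici 0).indicator f (y - x) ∂μ := by
        rw [← lintegral_indicator measurableSet_Ioi]
        refine lintegral_congr fun x => ?_
        rw [lintegral_const_mul _ (by fun_prop), ← up_apply_indicator hf,
          indicator_mul_left (f := t)]
    _ = ∫⁻ y, (∫⁻ x, (Ioi 0).indicator t x * (Ici 0).indicator f (y - x)) ∂μ := by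
        refine lintegral_lintegral_swap ?_
        fun_prop
    _ = ∫⁻ y, (∫⁻ x, (Ioi 0).indicator t (y - x) * (Ici 0).indicator f x) ∂μ := by
        refine lintegral_congr fun y => ?_
        rw [← lintegral_sub_left_eq_self (μ := volume)
          (fun x => (Ioi 0).indicator t (y - x) * (Ici 0).indicator f x) y]
        simp
    _ = ∫⁻ x, ∫⁻ y, (Ioi 0).indicator t (y - x) * (Ici 0).indicator f x ∂μ := by
        refine lintegral_lintegral_swap ?_
        fun_prop
    _ = ∫⁻ x in Ici 0, (∫⁻ y, (Ioi 0).indicator t (y - x) ∂μ) * f x := by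
        rw [setLIntegral_mul_eq measurableSet_Ici]
        exact lintegral_congr fun x => lintegral_mul_const _ (by fun_prop)
    _ = _ := setLIntegral_congr Ioi_ae_eq_Ici.symm

/-! ### The densities of `nu` and `rho` -/

/-- The tail of `μ`, which is the density of `nu`. -/
noncomputable def tail (μ : Measure ℝ) (x : ℝ) : ℝ≥0∞ := μ (Ioi x)

theorem measurable_tail {μ : Measure ℝ} : Measurable (tail μ) :=
  Antitone.measurable fun _ _ h => measure_mono (Ioi_subset_Ioi h)

/-- The two functions differ only at atoms of `μ`, which are countably many. -/
theorem tail_ae_eq : tail μ =ᵐ[volume] fun x => μ (Ici x) := by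
  have hc : {x : ℝ | 0 < μ {x}}.Countable :=
    Measure.countable_meas_pos_of_disjoint_iUnion (fun x => measurableSet_singleton x)
      fun x y h => disjoint_singleton.2 h
  filter_upwards [hc.ae_notMem volume] with x hx
  have hx : μ {x} = 0 := by simpa using hx
  exact measure_congr (Ioi_ae_eq_Ici' hx)

/-- The density of `rho`. -/
noncomputable def rhoDensity (μ : Measure ℝ) (x : ℝ) : ℝ≥0∞ :=
  ∫⁻ y in Ici 0, μ (Ioc x (x + y)) ∂μ

theorem measurable_measure_Ioc : Measurable fun z : ℝ × ℝ => μ (Ioc z.1 (z.1 + z.2)) := by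
  have hS : MeasurableSet {w : (ℝ × ℝ) × ℝ | w.1.1 < w.2 ∧ w.2 ≤ w.1.1 + w.1.2} :=
    (measurableSet_lt measurable_fst.fst measurable_snd).inter
      (measurableSet_le measurable_snd (measurable_fst.fst.add measurable_fst.snd))
  exact measurable_measure_prodMk_left hS

theorem measurable_rhoDensity : Measurable (rhoDensity μ) :=
  measurable_measure_Ioc.lintegral_prod_right' (ν := μ.restrict (Ici 0))

theorem restrict_Ici_zero {μ : Measure ℝ} (hμ : μ (Iio 0) = 0) : μ.restrict (Ici 0) = μ := by
  refine Measure.restrict_eq_self_of_ae_mem ?_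
  filter_upwards [measure_eq_zero_iff_ae_notMem.1 hμ] with y hy
  simpa using hy

theorem rhoDensity_le_tail (x : ℝ) : rhoDensity μ x ≤ tail μ x := by
  calc rhoDensity μ x ≤ ∫⁻ _ in Ici 0, tail μ x ∂μ :=
        lintegral_mono fun y => measure_mono Ioc_subset_Ioi_self
    _ = tail μ x * μ (Ici 0) := setLIntegral_const _ _
    _ ≤ tail μ x := mul_le_of_le_one_right' prob_le_one

theorem tail_le_one (x : ℝ) : tail μ x ≤ 1 := prob_le_one

/-- This is `ν = ν A + ρ` for densities: cut `(x, ∞)` at `x + y` and average over `y`. -/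
theorem tail_eq (hμ : μ (Iio 0) = 0) (x : ℝ) : tail μ x = shift μ (tail μ) x + rhoDensity μ x := by
  rw [rhoDensity, restrict_Ici_zero hμ, shift,
    ← lintegral_add_left (f := fun y => tail μ (x + y))
      (measurable_tail.comp (measurable_const_add x))]
  have h : ∀ᵐ y ∂μ, tail μ (x + y) + μ (Ioc x (x + y)) = tail μ x := by
    filter_upwards [measure_eq_zero_iff_ae_notMem.1 hμ] with y hy
    rw [mem_Iio, not_lt] at hy
    rw [tail, tail, ← Ioc_union_Ioi_eq_Ioi (le_add_of_nonneg_right hy : x ≤ x + y),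
      measure_union (Ioc_disjoint_Ioi le_rfl) measurableSet_Ioi,
      add_comm]
  rw [lintegral_congr_ae h]
  simp

/-- Both sides are the `μ ⊗ μ`-measure of `{(y, z) | x < y ≤ x + z}`, integrated in the two orders.
The right side is the form in which duality produces the density of `ν B`. -/
theorem rhoDensity_eq (hμ : μ (Iio 0) = 0) (x : ℝ) :
    rhoDensity μ x = ∫⁻ y, (Ioi 0).indicator (fun u => μ (Ici u)) (y - x) ∂μ := by
  have hswap : ∫⁻ y, ∫⁻ z, (if x < y ∧ y ≤ x + z then 1 else 0) ∂μ ∂μ =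
      ∫⁻ z, ∫⁻ y, (if x < y ∧ y ≤ x + z then 1 else (0 : ℝ≥0∞)) ∂μ ∂μ := by
    refine lintegral_lintegral_swap (Measurable.aemeasurable ?_)
    exact Measurable.ite ((measurableSet_lt measurable_const measurable_fst).inter
      (measurableSet_le measurable_fst (measurable_const.add measurable_snd))) measurable_const measurable_const
  rw [rhoDensity, restrict_Ici_zero hμ]
  calc _ = ∫⁻ z, ∫⁻ y, (if x < y ∧ y ≤ x + z then 1 else (0 : ℝ≥0∞)) ∂μ ∂μ := by
        refine lintegral_congr fun z => ?_
        rw [← lintegral_indicator_one measurableSet_Ioc]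
        exact lintegral_congr fun y => by simp only [indicator, mem_Ioc, Pi.one_apply]
    _ = ∫⁻ y, ∫⁻ z, (if x < y ∧ y ≤ x + z then 1 else (0 : ℝ≥0∞)) ∂μ ∂μ := hswap.symm
    _ = _ := by
        refine lintegral_congr fun y => ?_
        by_cases h : x < y
        · rw [indicator_of_mem (mem_Ioi.2 (sub_pos.2 h)),
            ← lintegral_indicator_one measurableSet_Ici]
          refine lintegral_congr fun z => ?_
          simp only [h, true_and, indicator, mem_Ici, sub_le_iff_le_add', Pi.one_apply]
        · rw [indicator_of_notMem (by simpa using h)]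
          simp [h]

theorem setLIntegral_tail_mul_up (hμ : μ (Iio 0) = 0) (hf : Measurable f) :
    ∫⁻ x in Ioi 0, tail μ x * up μ f x = ∫⁻ x in Ioi 0, rhoDensity μ x * f x := by
  have hm : Measurable fun x => μ (Ici x) :=
    Antitone.measurable fun _ _ h => measure_mono (Ici_subset_Ici.2 h)
  simp_rw [rhoDensity_eq hμ]
  rw [← setLIntegral_mul_up hm hf]
  refine lintegral_congr_ae ?_
  filter_upwards [ae_restrict_of_ae (tail_ae_eq (μ := μ))] with x hx
  rw [hx]

/-- The relation `ν = ρ + ν A` iterated `n` times, with remainder `ν Aⁿ`. -/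
theorem setLIntegral_tail_mul (hμ : μ (Iio 0) = 0) (hf : Measurable f) (n : ℕ) :
    ∫⁻ x in Ioi 0, tail μ x * f x =
      (∑ k ∈ Finset.range n, ∫⁻ x in Ioi 0, rhoDensity μ x * (down μ)^[k] f x) +
        ∫⁻ x in Ioi 0, tail μ x * (down μ)^[n] f x := by
  induction n with
  | zero => simp
  | succ n ih =>
    have hn := measurable_down_iterate (μ := μ) hf n
    have hstep : ∫⁻ x in Ioi 0, tail μ x * (down μ)^[n] f x =
        (∫⁻ x in Ioi 0, rhoDensity μ x * (down μ)^[n] f x) +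
          ∫⁻ x in Ioi 0, tail μ x * (down μ)^[n + 1] f x := by
      rw [Function.iterate_succ_apply', setLIntegral_mul_down hμ measurable_tail hn,
        ← lintegral_add_left (f := fun x => rhoDensity μ x * (down μ)^[n] f x)
          (measurable_rhoDensity.mul hn)]
      refine lintegral_congr fun x => ?_
      rw [← add_mul, add_comm, ← tail_eq hμ]
    rw [ih, hstep, Finset.sum_range_succ, add_assoc]

theorem setLIntegral_mul_down_iterate (hμ : μ (Iio 0) = 0) (ht : Measurable t)
    (hf : Measurable f) (n : ℕ) :
    ∫⁻ x in Ioi 0, t x * (down μ)^[n] f x =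
      ∫⁻ x in Ioi 0, (shift μ)^[n] t x * f x := by
  induction n generalizing t with
  | zero => rfl
  | succ n ih =>
    rw [Function.iterate_succ_apply', setLIntegral_mul_down hμ ht (measurable_down_iterate hf n),
      ih (measurable_shift ht), Function.iterate_succ_apply]

/-- Both sides are the probability that `Y₀ > x + Y₁ + ⋯ + Yₙ`. This form makes the decay of `ν Aⁿ`
a consequence of that of `Aⁿ 1`. -/
theorem shift_iterate_tail (hμ : μ (Iio 0) = 0) (n : ℕ) (x : ℝ) :
    (shift μ)^[n] (tail μ) x = ∫⁻ z in Ioi x, (down μ)^[n] 1 (z - x) ∂μ := by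
  induction n generalizing x with
  | zero => simp [tail]
  | succ n ih =>
    set h : ℝ → ℝ≥0∞ := (down μ)^[n] 1 with hh
    have hm : Measurable h := measurable_down_iterate measurable_one n
    have hH : Measurable ((Ioi 0).indicator h) := hm.indicator measurableSet_Ioi
    rw [Function.iterate_succ_apply', Function.iterate_succ_apply', ← hh]
    calc shift μ ((shift μ)^[n] (tail μ)) x
        = ∫⁻ y, ∫⁻ z, (Ioi 0).indicator h (z - x - y) ∂μ ∂μ := by
          refine lintegral_congr fun y => ?_
          rw [ih, ← lintegral_indicator measurableSet_Ioi]
          refine lintegral_congr fun z => ?_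
          simp only [indicator, mem_Ioi, lt_sub_iff_add_lt', sub_sub]
          simp only [add_zero]
      _ = ∫⁻ z, ∫⁻ y, (Ioi 0).indicator h (z - x - y) ∂μ ∂μ := by
          refine lintegral_lintegral_swap ?_
          fun_prop
      _ = ∫⁻ z, down μ h (z - x) ∂μ :=
          lintegral_congr fun z => (down_apply_indicator hm _).symm
      _ = _ := by
          rw [← lintegral_indicator measurableSet_Ioi]
          refine lintegral_congr fun z => ?_
          by_cases hz : x < z
          · rw [indicator_of_mem (mem_Ioi.2 hz)]
          · rw [indicator_of_notMem (by simpa using hz),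
              down_eq_zero hμ hm (sub_nonpos.2 (not_lt.1 hz))]

theorem shift_iterate_tail_le (hμ : μ (Iio 0) = 0) (n : ℕ) (x : ℝ) :
    (shift μ)^[n] (tail μ) x ≤ tail μ x := by
  rw [shift_iterate_tail hμ]
  calc _ ≤ ∫⁻ _ in Ioi x, 1 ∂μ := lintegral_mono fun z => down_iterate_one_le n _
    _ = _ := by simp [tail]

theorem tendsto_shift_iterate_tail (hμ : μ (Iio 0) = 0) (hnl : NonLattice μ) (x : ℝ) :
    Filter.Tendsto (fun n => (shift μ)^[n] (tail μ) x) Filter.atTop (nhds 0) := by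
  simp_rw [shift_iterate_tail hμ]
  have h := tendsto_lintegral_of_dominated_convergence (μ := μ.restrict (Ioi x))
    (F := fun n z => (down μ)^[n] 1 (z - x)) (f := fun _ => 0) (fun _ => 1)
    (fun n => (measurable_down_iterate measurable_one n).comp (measurable_sub_const x))
    (fun n => ae_of_all _ fun z => down_iterate_one_le n _) (by simp) ?_
  · simpa using h
  · refine (ae_restrict_iff' measurableSet_Ioi).2 (ae_of_all _ fun z hz => ?_)
    exact tendsto_down_iterate_one hμ hnl (sub_nonneg.2 (mem_Ioi.1 hz).le)

/-- `ν = ∑ ρ Aᵏ`, where `A` is the killed kernel. -/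
theorem tsum_rhoDensity_mul_down_iterate (hμ : μ (Iio 0) = 0) (hnl : NonLattice μ)
    (hf : Measurable f) (hfin : ∫⁻ x in Ioi 0, tail μ x * f x ≠ ∞) :
    ∑' k, ∫⁻ x in Ioi 0, rhoDensity μ x * (down μ)^[k] f x = ∫⁻ x in Ioi 0, tail μ x * f x := by
  have hlim : Filter.Tendsto (fun n => ∫⁻ x in Ioi 0, tail μ x * (down μ)^[n] f x)
      Filter.atTop (nhds 0) := by
    simp_rw [setLIntegral_mul_down_iterate hμ measurable_tail hf]
    have hbound := (ae_lt_top (measurable_tail.mul hf) hfin)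
    have h := tendsto_lintegral_of_dominated_convergence (μ := volume.restrict (Ioi (0 : ℝ)))
      (F := fun n x => (shift μ)^[n] (tail μ) x * f x) (f := fun _ => 0)
      (fun x => tail μ x * f x)
      (fun n => (measurable_shift_iterate measurable_tail n).mul hf)
      (fun n => ae_of_all _ fun x => mul_le_mul_left (shift_iterate_tail_le hμ n x) _) hfin ?_
    · simpa using h
    · filter_upwards [hbound] with x hx
      -- Where `f` is infinite, finiteness of `tail μ x * f x` forces the tail, and so all its
      -- shifts, to vanish.
      by_cases hfx : f x = ∞
      · have h0 : tail μ x = 0 := by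
          by_contra h0
          rw [Pi.mul_apply, hfx, ENNReal.mul_top h0] at hx
          exact lt_irrefl _ hx
        have : ∀ n, (shift μ)^[n] (tail μ) x = 0 := fun n =>
          le_antisymm ((shift_iterate_tail_le hμ n x).trans h0.le) zero_le
        simp [this]
      · simpa using ENNReal.Tendsto.mul_const (tendsto_shift_iterate_tail hμ hnl x) (.inr hfx)
  have hadd := (ENNReal.summable.hasSum
    (f := fun k => ∫⁻ x in Ioi 0, rhoDensity μ x * (down μ)^[k] f x)).tendsto_sum_nat.add hlim
  rw [add_zero] at hadd
  refine tendsto_nhds_unique hadd ?_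
  exact tendsto_const_nhds.congr fun n => setLIntegral_tail_mul hμ hf n

end
section

/-! ### The state space, `nu` and `rho` -/

section StateSpace

variable {μ : Measure ℝ}

theorem measurableSet_stateSpace : MeasurableSet (stateSpace μ) :=
  (measurableSet_le measurable_const measurable_id).inter
    (measurableSet_le measurable_coe_real_ereal measurable_const)

theorem stateSpace_subset : stateSpace μ ⊆ Ici 0 := fun _ h => h.1

theorem mem_stateSpace_of_le {x y : ℝ} (hx : 0 ≤ x) (hxy : x ≤ y) (hy : y ∈ stateSpace μ) :
    x ∈ stateSpace μ :=
  ⟨hx, (EReal.coe_le_coe_iff.2 hxy).trans hy.2⟩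

theorem ae_mem_stateSpace (hμ : μ (Iio 0) = 0) : ∀ᵐ y ∂μ, y ∈ stateSpace μ := by
  filter_upwards [Measure.support_mem_ae (μ := μ), measure_eq_zero_iff_ae_notMem.1 hμ] with y h1 h2
  exact ⟨by simpa using h2, le_iSup₂ (f := fun (y : ℝ) (_ : y ∈ μ.support) => (y : EReal)) y h1⟩

theorem tail_eq_zero (hμ : μ (Iio 0) = 0) {x : ℝ} (hx : 0 ≤ x) (hxs : x ∉ stateSpace μ) :
    tail μ x = 0 := by
  refine measure_mono_null (t := (stateSpace μ)ᶜ) (fun y hy hys => ?_) (ae_mem_stateSpace hμ)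
  exact hxs (mem_stateSpace_of_le hx (mem_Ioi.1 hy).le hys)

/-- Enlarging the state space to the half-line costs nothing where the density vanishes, and the
endpoint 0 is a null set. -/
theorem lintegral_withDensity_stateSpace {d f : ℝ → ℝ≥0∞} (hd : Measurable d) (hf : Measurable f)
    (h0 : ∀ x, 0 ≤ x → x ∉ stateSpace μ → d x = 0) :
    ∫⁻ x, f x ∂(volume.restrict (stateSpace μ)).withDensity d = ∫⁻ x in Ioi 0, d x * f x := by
  rw [lintegral_withDensity_eq_lintegral_mul _ hd hf, ← lintegral_indicator
    measurableSet_stateSpace, setLIntegral_congr Ioi_ae_eq_Ici, ← lintegral_indicator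
    measurableSet_Ici]
  refine lintegral_congr fun x => ?_
  by_cases hx : x ∈ stateSpace μ
  · rw [indicator_of_mem hx, indicator_of_mem (stateSpace_subset hx), Pi.mul_apply]
  · rw [indicator_of_notMem hx]
    by_cases hx0 : x ∈ Ici (0 : ℝ)
    · rw [indicator_of_mem hx0, h0 x hx0 hx, zero_mul]
    · rw [indicator_of_notMem hx0]

end StateSpace

variable {μ : Measure ℝ} [IsProbabilityMeasure μ] {f : ℝ → ℝ≥0∞}

theorem one_sub_measure_Icc (hμ : μ (Iio 0) = 0) {x : ℝ} (hx : 0 ≤ x) :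
    1 - μ (Icc 0 x) = tail μ x := by
  have h : μ (Icc 0 x) = μ (Iic x) := by
    refine le_antisymm (measure_mono Icc_subset_Iic_self) ?_
    rw [← Iio_union_Icc_eq_Iic hx]
    simpa [hμ] using measure_union_le (μ := μ) (Iio 0) (Icc 0 x)
  rw [h, ← prob_compl_eq_one_sub measurableSet_Iic, compl_Iic, tail]

theorem nu_eq (hμ : μ (Iio 0) = 0) :
    nu μ = (volume.restrict (stateSpace μ)).withDensity (tail μ) := by
  refine withDensity_congr_ae ?_
  filter_upwards [ae_restrict_mem measurableSet_stateSpace] with x hx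
  exact one_sub_measure_Icc hμ hx.1

theorem lintegral_nu (hμ : μ (Iio 0) = 0) (hf : Measurable f) :
    ∫⁻ x, f x ∂nu μ = ∫⁻ x in Ioi 0, tail μ x * f x := by
  rw [nu_eq hμ]
  exact lintegral_withDensity_stateSpace measurable_tail hf fun x => tail_eq_zero hμ

theorem lintegral_rho (hμ : μ (Iio 0) = 0) (hf : Measurable f) :
    ∫⁻ x, f x ∂rho μ = ∫⁻ x in Ioi 0, rhoDensity μ x * f x :=
  lintegral_withDensity_stateSpace measurable_rhoDensity hf fun x hx hxs =>
    le_antisymm ((rhoDensity_le_tail x).trans (tail_eq_zero hμ hx hxs).le) zero_le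

/-- The measure `rho` is the image of `nu` under a reflected step. -/
theorem lintegral_nu_up (hμ : μ (Iio 0) = 0) (hf : Measurable f) :
    ∫⁻ x, up μ f x ∂nu μ = ∫⁻ x, f x ∂rho μ := by
  rw [lintegral_nu hμ (measurable_up hf), lintegral_rho hμ hf, setLIntegral_tail_mul_up hμ hf]

theorem rho_le_volume : rho μ ≤ volume := by
  refine Measure.le_iff.2 fun s hs => ?_
  rw [rho, withDensity_apply _ hs]
  calc _ ≤ ∫⁻ _ in s, 1 ∂volume.restrict (stateSpace μ) :=
        lintegral_mono fun x => (rhoDensity_le_tail x).trans (tail_le_one x)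
    _ ≤ volume s := by
        rw [setLIntegral_one]
        exact Measure.restrict_apply_le _ _

theorem locallyFinite_rho : IsLocallyFiniteMeasure (rho μ) :=
  Measure.isLocallyFiniteMeasure_of_le rho_le_volume

theorem invariant_rho (hμ : μ (Iio 0) = 0) (hnl : NonLattice μ) :
    (reflKernel μ).Invariant (rho μ) := by
  -- Finite volume makes `∫ B 1ₛ dν = ρ s` finite, as the series for `ν` requires.
  have hbdd : ∀ s, MeasurableSet s → volume s ≠ ∞ →
      ((rho μ).bind (reflKernel μ)) s = rho μ s := by
    intro s hs hfin
    have hf : Measurable (s.indicator (1 : ℝ → ℝ≥0∞)) := measurable_one.indicator hs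
    have hrho := lintegral_rho hμ hf
    rw [lintegral_indicator_one hs] at hrho
    have hne : rho μ s ≠ ∞ := ((rho_le_volume s).trans_lt hfin.lt_top).ne
    calc ((rho μ).bind (reflKernel μ)) s
        = ∫⁻ x, ∫⁻ z, s.indicator 1 z ∂reflKernel μ x ∂rho μ := by
          rw [← lintegral_indicator_one hs,
            Measure.lintegral_bind (reflKernel μ).aemeasurable hf.aemeasurable]
      _ = ∫⁻ x in Ioi 0, rhoDensity μ x * ∑' k, (down μ)^[k] (up μ (s.indicator 1)) x := by
          rw [lintegral_rho hμ hf.lintegral_kernel]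
          refine setLIntegral_congr_fun measurableSet_Ioi fun x hx => ?_
          rw [lintegral_reflKernel_eq_tsum hμ hnl hf
            (fun x => indicator_le_self' (fun _ _ => zero_le) x) (mem_Ioi.1 hx).le]
      _ = ∑' k, ∫⁻ x in Ioi 0, rhoDensity μ x * (down μ)^[k] (up μ (s.indicator 1)) x := by
          simp_rw [← ENNReal.tsum_mul_left]
          exact lintegral_tsum fun k => (measurable_rhoDensity.mul
            (measurable_down_iterate (measurable_up hf) k)).aemeasurable
      _ = rho μ s := by
          have h := setLIntegral_tail_mul_up hμ hf
          rw [tsum_rhoDensity_mul_down_iterate hμ hnl (measurable_up hf) (by rwa [h, ← hrho]), h,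
            hrho]
  have hU : ⋃ n : ℕ, Icc (-(n : ℝ)) n = univ := by
    refine eq_univ_of_forall fun x => ?_
    obtain ⟨n, hn⟩ := exists_nat_ge |x|
    exact mem_iUnion.2 ⟨n, abs_le.1 hn⟩
  refine (Measure.ext_iff_of_iUnion_eq_univ hU).2 fun n => Measure.ext fun s hs => ?_
  rw [Measure.restrict_apply hs, Measure.restrict_apply hs]
  exact hbdd _ (hs.inter measurableSet_Icc)
    ((measure_mono inter_subset_right).trans_lt measure_Icc_lt_top).ne

theorem up_indicator_one {s : Set ℝ} (hs : MeasurableSet s) (x : ℝ) :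
    up μ (s.indicator 1) x = μ {y | y - x ∈ s ∧ x ≤ y} := by
  have hm : Measurable fun y : ℝ => y - x := measurable_sub_const x
  rw [up, lintegral_indicator_one hs]
  exact (Measure.map_apply hm hs).trans (Measure.restrict_apply (hm hs))

theorem exists_measure_Ioi_ne_zero {μ : Measure ℝ} (hμ : μ (Iio 0) = 0) (hnl : NonLattice μ) :
    ∃ ε, 0 < ε ∧ μ (Ioi ε) ≠ 0 := by
  by_contra! hall
  have h0 : μ (⋃ n : ℕ, Ioi (1 / ((n : ℝ) + 1))) = 0 :=
    measure_iUnion_null fun n => hall _ (by positivity)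
  refine (truncMean_pos hμ hnl).ne' ?_
  refine (lintegral_congr_ae ?_).trans lintegral_zero
  filter_upwards [measure_eq_zero_iff_ae_notMem.1 h0] with y hy
  have hy0 : y ≤ 0 := by
    by_contra hpos
    obtain ⟨n, hn⟩ := exists_nat_one_div_lt (not_le.1 hpos)
    exact hy (mem_iUnion.2 ⟨n, hn⟩)
  exact ENNReal.ofReal_eq_zero.2 ((min_le_left _ _).trans hy0)

/-- The total mass is `∫ B 1 dν`, and on `(0, ε)` both the density of `ν` and `B 1` are at least `μ
(Ioi ε) > 0`. -/
theorem rho_ne_zero (hμ : μ (Iio 0) = 0) (hnl : NonLattice μ) : rho μ ≠ 0 := by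
  intro h
  obtain ⟨ε, hε, hpos⟩ := exists_measure_Ioi_ne_zero hμ hnl
  have hzero := lintegral_nu_up hμ (measurable_one (α := ℝ≥0∞) (β := ℝ))
  rw [h, lintegral_zero_measure, lintegral_nu hμ (measurable_up measurable_one)] at hzero
  have hle : ∫⁻ _ in Ioo 0 ε, μ (Ioi ε) * μ (Ioi ε) ≤ ∫⁻ x in Ioi 0, tail μ x * up μ 1 x := by
    refine (setLIntegral_mono' measurableSet_Ioo fun x hx => ?_).trans
      (lintegral_mono_set Ioo_subset_Ioi_self)
    refine mul_le_mul' (measure_mono (Ioi_subset_Ioi hx.2.le)) ?_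
    rw [← indicator_univ (1 : ℝ → ℝ≥0∞), up_indicator_one MeasurableSet.univ]
    exact measure_mono fun y hy => ⟨mem_univ _, (hx.2.trans (mem_Ioi.1 hy)).le⟩
  rw [hzero, setLIntegral_const, Real.volume_Ioo, sub_zero, nonpos_iff_eq_zero, mul_eq_zero,
    mul_self_eq_zero, ENNReal.ofReal_eq_zero] at hle
  exact hle.elim hpos (not_le.2 hε)

theorem isInvariantRadonOn_rho (hμ : μ (Iio 0) = 0) (hnl : NonLattice μ) :
    IsInvariantRadonOn (reflKernel μ) (stateSpace μ) (rho μ) where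
  ne_zero := rho_ne_zero hμ hnl
  locallyFinite := locallyFinite_rho
  compl_eq_zero := by
    refine withDensity_absolutelyContinuous _ _ ?_
    rw [Measure.restrict_apply measurableSet_stateSpace.compl, compl_inter_self, measure_empty]
  invariant := invariant_rho hμ hnl

end
section

/-! ### From the process of reflections back to the reflected walk -/

/-- The image of `m` under `n` steps without reflection. -/
noncomputable def killedMeasure (μ : Measure ℝ) [IsProbabilityMeasure μ] (m : Measure ℝ) (n : ℕ) :
    Measure ℝ :=
  (fun m' : Measure ℝ => m'.bind (downKernel μ))^[n] m

/-- The measure of the visits before the first reflection, for the initial measure `m`. -/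
noncomputable def potentialMeasure (μ : Measure ℝ) [IsProbabilityMeasure μ] (m : Measure ℝ) :
    Measure ℝ :=
  Measure.sum (killedMeasure μ m)

variable {μ m : Measure ℝ} [IsProbabilityMeasure μ] {f : ℝ → ℝ≥0∞}

theorem killedMeasure_succ (n : ℕ) :
    killedMeasure μ m (n + 1) = (killedMeasure μ m n).bind (downKernel μ) :=
  Function.iterate_succ_apply' _ _ _

theorem lintegral_killedMeasure (hf : Measurable f) (n : ℕ) :
    ∫⁻ x, f x ∂killedMeasure μ m n = ∫⁻ x, (down μ)^[n] f x ∂m := by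
  induction n generalizing f with
  | zero => rfl
  | succ n ih =>
    rw [killedMeasure_succ, Measure.lintegral_bind (downKernel μ).aemeasurable hf.aemeasurable,
      Function.iterate_succ_apply]
    exact ih (measurable_down hf)

theorem lintegral_potentialMeasure (hf : Measurable f) :
    ∫⁻ x, f x ∂potentialMeasure μ m = ∑' k, ∫⁻ x, (down μ)^[k] f x ∂m := by
  rw [potentialMeasure, lintegral_sum_measure]
  exact tsum_congr fun k => lintegral_killedMeasure hf k

theorem le_potentialMeasure : m ≤ potentialMeasure μ m :=
  Measure.le_sum (killedMeasure μ m) 0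

/-- Separating the term `k = 0` gives `M = m + M A`. -/
theorem lintegral_potentialMeasure_eq_add (hf : Measurable f) :
    ∫⁻ x, f x ∂potentialMeasure μ m =
      ∫⁻ x, f x ∂m + ∫⁻ x, down μ f x ∂potentialMeasure μ m := by
  rw [lintegral_potentialMeasure hf, lintegral_potentialMeasure (measurable_down hf),
    tsum_eq_zero_add' ENNReal.summable]
  rfl

theorem potentialMeasure_compl_eq_zero {S : Set ℝ} (hS : MeasurableSet S) (hm : m Sᶜ = 0)
    (h : ∀ x ∈ S, ∀ᵐ z ∂downKernel μ x, z ∈ S) : potentialMeasure μ m Sᶜ = 0 := by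
  rw [potentialMeasure, Measure.sum_apply _ hS.compl, ENNReal.tsum_eq_zero]
  intro n
  induction n with
  | zero => exact hm
  | succ n ih =>
    rw [killedMeasure_succ, Measure.bind_apply hS.compl (downKernel μ).aemeasurable]
    refine (lintegral_congr_ae ?_).trans lintegral_zero
    filter_upwards [measure_eq_zero_iff_ae_notMem.1 ih] with x hx
    exact h x (not_notMem.1 hx)

theorem ae_downKernel_le (hμ : μ (Iio 0) = 0) (x : ℝ) : ∀ᵐ z ∂downKernel μ x, z ≤ x := by
  have hm : Measurable fun y : ℝ => x - y := by fun_prop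
  change ∀ᵐ z ∂((μ.restrict (Iio x)).map fun y => x - y), z ≤ x
  rw [ae_map_iff hm.aemeasurable measurableSet_Iic]
  refine ae_restrict_of_ae ?_
  filter_upwards [measure_eq_zero_iff_ae_notMem.1 hμ] with y hy
  simpa using hy

theorem potentialMeasure_Iio_zero (hm0 : m (Iio 0) = 0) : potentialMeasure μ m (Iio 0) = 0 := by
  rw [← compl_Ici] at hm0 ⊢
  exact potentialMeasure_compl_eq_zero measurableSet_Ici hm0
    fun x _ => (ae_downKernel_pos x).mono fun z hz => hz.le

/-- The potential of an invariant measure of the process of reflections returns that measure after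
a reflected step. -/
theorem lintegral_up_potentialMeasure (hμ : μ (Iio 0) = 0) (hnl : NonLattice μ)
    (hm0 : m (Iio 0) = 0) (hinv : (reflKernel μ).Invariant m) (hf : Measurable f)
    (hf1 : ∀ x, f x ≤ 1) : ∫⁻ x, up μ f x ∂potentialMeasure μ m = ∫⁻ x, f x ∂m := by
  rw [lintegral_potentialMeasure (measurable_up hf), ← lintegral_tsum fun k =>
    (measurable_down_iterate (measurable_up hf) k).aemeasurable]
  conv_rhs => rw [← hinv.def,
    Measure.lintegral_bind (reflKernel μ).aemeasurable hf.aemeasurable]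
  refine lintegral_congr_ae ?_
  filter_upwards [measure_eq_zero_iff_ae_notMem.1 hm0] with x hx
  exact (lintegral_reflKernel_eq_tsum hμ hnl hf hf1 (not_lt.1 hx)).symm

/-- `M A + M B = M A + m = M`; nothing is subtracted, so `M` may be infinite here. -/
theorem invariant_potentialMeasure (hμ : μ (Iio 0) = 0) (hnl : NonLattice μ)
    (hm0 : m (Iio 0) = 0) (hinv : (reflKernel μ).Invariant m) :
    (walkKernel μ).Invariant (potentialMeasure μ m) := by
  refine Measure.ext fun s hs => ?_
  have hf : Measurable (s.indicator (1 : ℝ → ℝ≥0∞)) := measurable_one.indicator hs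
  rw [← lintegral_indicator_one hs, ← lintegral_indicator_one hs,
    Measure.lintegral_bind (walkKernel μ).aemeasurable hf.aemeasurable,
    lintegral_potentialMeasure_eq_add hf]
  simp_rw [lintegral_walkKernel hf]
  rw [lintegral_add_left (measurable_down hf), lintegral_up_potentialMeasure hμ hnl hm0 hinv hf
    fun x => indicator_le_self' (fun _ _ => zero_le) x, add_comm]

theorem lintegral_measure_eq (hμ : μ (Iio 0) = 0) (hnl : NonLattice μ)
    (hm0 : m (Iio 0) = 0) (hinv : (reflKernel μ).Invariant m) {s : Set ℝ} (hs : MeasurableSet s) :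
    ∫⁻ x, μ {y | y - x ∈ s ∧ x ≤ y} ∂potentialMeasure μ m = m s := by
  rw [← lintegral_indicator_one hs, ← lintegral_up_potentialMeasure hμ hnl hm0 hinv
    (measurable_one.indicator hs) fun x => indicator_le_self' (fun _ _ => zero_le) x]
  exact lintegral_congr fun x => (up_indicator_one hs x).symm

/-- Since `m = M B`, the measure `m` charges only what a reflected step can reach. -/
theorem measure_eq_zero_of_reflection (hμ : μ (Iio 0) = 0) (hnl : NonLattice μ)
    (hm0 : m (Iio 0) = 0) (hinv : (reflKernel μ).Invariant m) {s : Set ℝ} (hs : MeasurableSet s)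
    (h : ∀ x, 0 ≤ x → μ {y | y - x ∈ s ∧ x ≤ y} = 0) : m s = 0 := by
  rw [← lintegral_measure_eq hμ hnl hm0 hinv hs]
  refine (lintegral_congr_ae ?_).trans lintegral_zero
  filter_upwards [measure_eq_zero_iff_ae_notMem.1 (potentialMeasure_Iio_zero (μ := μ) hm0)]
    with x hx
  exact h x (not_lt.1 hx)

/-- Every invariant measure of the process of reflections lives on the state space. -/
theorem measure_compl_stateSpace (hμ : μ (Iio 0) = 0) (hnl : NonLattice μ)
    (hm0 : m (Iio 0) = 0) (hinv : (reflKernel μ).Invariant m) : m (stateSpace μ)ᶜ = 0 := by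
  refine measure_eq_zero_of_reflection hμ hnl hm0 hinv measurableSet_stateSpace.compl
    fun x hx => measure_mono_null (t := (stateSpace μ)ᶜ) ?_ (ae_mem_stateSpace hμ)
  rintro y ⟨hy, hxy⟩ hys
  exact hy (mem_stateSpace_of_le (sub_nonneg.2 hxy) (by linarith) hys)

theorem potentialMeasure_compl_stateSpace (hμ : μ (Iio 0) = 0) (hnl : NonLattice μ)
    (hm0 : m (Iio 0) = 0) (hinv : (reflKernel μ).Invariant m) :
    potentialMeasure μ m (stateSpace μ)ᶜ = 0 := by
  refine potentialMeasure_compl_eq_zero measurableSet_stateSpace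
    (measure_compl_stateSpace hμ hnl hm0 hinv) fun x hx => ?_
  filter_upwards [ae_downKernel_pos x, ae_downKernel_le hμ x] with z h1 h2
  exact mem_stateSpace_of_le h1.le h2 hx

/-- If `μ` is unbounded, choose `L` with `μ (Icc K L) ≠ 0`: from any point of `[0, K]` an increment
in `[K, L]` reflects into `[0, L]`, so `M [0, K] · μ [K, L] ≤ m [0, L] < ∞`. If `μ` is bounded, `m`
is finite and lives on some `[0, L]`, where the expected number of visits before reflection is at
most `(1 + L) / truncMean μ`, so `M` is finite. -/
theorem potentialMeasure_Icc_lt_top [IsLocallyFiniteMeasure m] (hμ : μ (Iio 0) = 0)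
    (hnl : NonLattice μ) (hm0 : m (Iio 0) = 0) (hinv : (reflKernel μ).Invariant m) (K : ℝ) :
    potentialMeasure μ m (Icc 0 K) < ∞ := by
  by_cases hunb : ∀ K, μ (Ici K) ≠ 0
  · obtain ⟨L, hL⟩ : ∃ L : ℕ, μ (Icc K L) ≠ 0 := by
      by_contra! hall
      refine hunb K (measure_mono_null (fun y hy => ?_) (measure_iUnion_null hall))
      obtain ⟨L, hL⟩ := exists_nat_ge y
      exact mem_iUnion.2 ⟨L, hy, hL⟩
    have hle : potentialMeasure μ m (Icc 0 K) * μ (Icc K L) ≤ m (Icc 0 (L : ℝ)) := by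
      rw [← lintegral_measure_eq hμ hnl hm0 hinv measurableSet_Icc, mul_comm, ← setLIntegral_const]
      refine (setLIntegral_mono' measurableSet_Icc fun x hx => measure_mono fun y hy => ?_).trans
        (setLIntegral_le_lintegral _ _)
      have hxy : x ≤ y := hx.2.trans hy.1
      exact ⟨⟨sub_nonneg.2 hxy, (sub_le_self _ hx.1).trans hy.2⟩, hxy⟩
    exact ENNReal.lt_top_of_mul_ne_top_left (hle.trans_lt measure_Icc_lt_top).ne hL
  · push Not at hunb
    obtain ⟨L, hL⟩ := hunb
    -- A reflected step lands at `y - x ≤ y`, so it cannot exceed `L`.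
    have hmL : m (Ioi L) = 0 := by
      refine measure_eq_zero_of_reflection hμ hnl hm0 hinv measurableSet_Ioi
        fun x hx => measure_mono_null (fun y hy => ?_) hL
      have := mem_Ioi.1 hy.1
      exact mem_Ici.2 (by linarith)
    have hmem : ∀ᵐ x ∂m, x ∈ Icc 0 L := by
      filter_upwards [measure_eq_zero_iff_ae_notMem.1 hm0,
        measure_eq_zero_iff_ae_notMem.1 hmL] with x h1 h2
      exact ⟨not_lt.1 h1, not_lt.1 h2⟩
    have hmfin : m univ < ∞ := by
      rw [← Measure.restrict_eq_self_of_ae_mem hmem, Measure.restrict_apply_univ]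
      exact measure_Icc_lt_top
    refine (measure_mono (subset_univ _)).trans_lt ?_
    rw [← lintegral_one, ← Pi.one_def, lintegral_potentialMeasure measurable_one,
      ← lintegral_tsum fun k => (measurable_down_iterate measurable_one k).aemeasurable]
    calc ∫⁻ x, ∑' k, (down μ)^[k] 1 x ∂m
        ≤ ∫⁻ _, ENNReal.ofReal (1 + L) / truncMean μ ∂m := by
          refine lintegral_mono_ae ?_
          filter_upwards [hmem] with x hx
          refine (tsum_down_iterate_one_le hμ hnl hx.1).trans ?_
          gcongr
          exact hx.2
      _ = ENNReal.ofReal (1 + L) / truncMean μ * m univ := lintegral_const _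
      _ < ∞ := ENNReal.mul_lt_top
          (ENNReal.div_lt_top ENNReal.ofReal_ne_top (truncMean_pos hμ hnl).ne') hmfin

theorem isInvariantRadonOn_potentialMeasure (hμ : μ (Iio 0) = 0) (hnl : NonLattice μ)
    (hm : IsInvariantRadonOn (reflKernel μ) (Ici 0) m) :
    IsInvariantRadonOn (walkKernel μ) (stateSpace μ) (potentialMeasure μ m) := by
  have hm0 : m (Iio 0) = 0 := by simpa using hm.compl_eq_zero
  have := hm.locallyFinite
  refine ⟨fun h0 => hm.ne_zero ?_, ⟨fun x => ⟨Iio (x + 1), Iio_mem_nhds (lt_add_one x), ?_⟩⟩,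
    potentialMeasure_compl_stateSpace hμ hnl hm0 hm.invariant,
    invariant_potentialMeasure hμ hnl hm0 hm.invariant⟩
  · exact Measure.measure_univ_eq_zero.1 (le_antisymm
      ((le_potentialMeasure (μ := μ) univ).trans (by simp [h0])) zero_le)
  · have hsub : Iio (x + 1) ⊆ Iio 0 ∪ Icc 0 (x + 1) := fun y hy =>
      (lt_or_ge y 0).imp id fun h => ⟨h, (mem_Iio.1 hy).le⟩
    refine (measure_mono hsub).trans_lt ((measure_union_le _ _).trans_lt ?_)
    rw [potentialMeasure_Iio_zero hm0, zero_add]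
    exact potentialMeasure_Icc_lt_top hμ hnl hm0 hm.invariant _

/-- Apply a reflected step to both sides: `m = M B = c ν B = c ρ`. -/
theorem eq_smul_rho_of_potentialMeasure_eq (hμ : μ (Iio 0) = 0) (hnl : NonLattice μ)
    (hm0 : m (Iio 0) = 0) (hinv : (reflKernel μ).Invariant m) {c : ℝ≥0}
    (hc : potentialMeasure μ m = c • nu μ) : m = c • rho μ := by
  refine Measure.ext fun s hs => ?_
  have hf : Measurable (s.indicator (1 : ℝ → ℝ≥0∞)) := measurable_one.indicator hs
  have h := lintegral_up_potentialMeasure hμ hnl hm0 hinv hf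
    fun x => indicator_le_self' (fun _ _ => zero_le) x
  rw [hc, lintegral_smul_measure, lintegral_nu_up hμ hf, lintegral_indicator_one hs,
    lintegral_indicator_one hs] at h
  rw [← h, Measure.smul_apply]

end

end ReflectedRandomWalk

open ReflectedRandomWalk in
theorem theorem4p5 (μ : MeasureTheory.Measure ℝ) [MeasureTheory.IsProbabilityMeasure μ]
    (hμ : μ (Set.Iio 0) = 0) (hnl : NonLattice μ) :
    IsInvariantRadonOn (reflKernel μ) (stateSpace μ) (rho μ) ∧
      ((∀ m : MeasureTheory.Measure ℝ, IsInvariantRadonOn (walkKernel μ) (stateSpace μ) m →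
          ∃ c : NNReal, m = c • nu μ) →
        ∀ m : MeasureTheory.Measure ℝ, IsInvariantRadonOn (reflKernel μ) (Set.Ici 0) m →
          ∃ c : NNReal, m = c • rho μ) := by
  refine ⟨isInvariantRadonOn_rho hμ hnl, fun hν m hm => ?_⟩
  obtain ⟨c, hc⟩ := hν _ (isInvariantRadonOn_potentialMeasure hμ hnl hm)
  exact ⟨c, eq_smul_rho_of_potentialMeasure_eq hμ hnl (by simpa using hm.compl_eq_zero)
    hm.invariant hc⟩
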